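/- For a nonzero vector $x\in\mathbb{R}^q$ ($q\ge 2$) let $\Pi(x)$ be the set of all permutations of $x$, let $e=(1,\dots,1)\in\mathbb{R}^q$ and $\bar x=\frac1q\sum_i x_i$. Let $\tilde M^{q-1}=\{v\in\mathbb{R}^q: v_1+\dots+v_q=0\}$ and let $\tilde S_\rho^{q-2}$ be the $0$-centred sphere of radius $\rho$ in $\tilde M^{q-1}$. For a nonzero $y\in\tilde M^{q-1}$ with $y_1\le\dots\le y_q$ let $$D^{q-2}(\Pi(y))=\sup_C\Big|\frac{|\Pi(y)\cap C|}{|\Pi(y)|}-\tilde U^{q-2}_{\|y\|}(C)\Big|,$$ where $\tilde U^{q-2}_{\rho}$ is the uniform distribution on $\tilde S^{q-2}_{\rho}$ and $C$ runs over the open spherical caps $\{v\in\tilde S^{q-2}_{\|y\|}: v'w>\|y\|^2t\}$, $w\in\tilde S^{q-2}_{\|y\|}$, $-1\le t<1$. A sequence $\{y^q\}$ of such vectors is called asymptotically permutation-uniform (APU) if $D^{q-2}(\Pi(y^q))\to0$ as $q\to\infty$; a sequence $\{x^q\}$ of non-constant vectors with nondecreasing coordinates in $\mathbb{R}^q$ is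 called APU if $\{x^q-\bar x^q e\}$ is APU. (Note that $\Pi(x-\bar xe)=\Pi(x)-\bar x e$.) For $0\le k\le q$ let $b_k^q=\sqrt{\frac{3k(q-k)}{q(q+1)}}$, let $\hat a^q$ be the vector with coordinates $\hat a_k^q=b_{k-1}^q-b_k^q$ $(1\le k\le q)$, and define the maximal configurations $$\hat y^q=\sqrt{\tfrac{q(q^2-1)}{12}}\;\frac{\hat a^q}{\|\hat a^q\|},\qquad \hat x^q=\hat y^q+\tfrac{q+1}{2}\,e .$$ **Proposition.** The sequences $\{\hat y^q\}$ and $\{\hat x^q\}$ are not APU. Moreover, if $Y^q$ is uniformly distributed on $\Pi(\hat y^q)$, then for every fixed $i\ge1$, as $q\to\infty$, $$\frac{\sqrt q}{\|\hat y^q\|}\,Y^q_i=O_p\Big(\frac1{\sqrt{\log q}}\Big),\qquad \frac{\sqrt q}{\|\hat y^q\|}\,Y^q_i\to0\ \text{ in probability},$$ so this standardized coordinate does not converge in distribution to $N(0,1)$. Such convergence is necessary for APU: if $\{y^q\}$ is any APU sequence of nonzero vectors $y^q\in\tilde M^{q-1}$ with nondecreasing coordinates, and $Y^q$ is uniformly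 distributed on $\Pi(y^q)$, then $\frac{\sqrt q}{\|y^q\|}Y^q_i$ converges in distribution to $N(0,1)$ for every fixed $i\ge1$. -/

import Mathlib

open MeasureTheory ProbabilityTheory Filter Topology

namespace PermUniform

noncomputable section

/-- The vector `(1, …, 1)` of `ℝ^q`. -/
def ones (q : ℕ) : EuclideanSpace ℝ (Fin q) := WithLp.toLp 2 fun _ => 1

/-- The linear hyperplane of `ℝ^q` of all vectors `v` with `v_1 + ⋯ + v_q = 0`. -/
def sumZero (q : ℕ) : Submodule ℝ (EuclideanSpace ℝ (Fin q)) := (Submodule.span ℝ {ones q})ᗮ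

/-- The projection `x ↦ x - x̄ e` of `ℝ^q` onto the sum-zero hyperplane, where `x̄` is the average
of the coordinates of `x` and `e = (1, …, 1)`. -/
def center {q : ℕ} (x : EuclideanSpace ℝ (Fin q)) : EuclideanSpace ℝ (Fin q) :=
  x - ((∑ i, x i) / q) • ones q

/-- The vector obtained from `x` by permuting its coordinates by `σ`. -/
def permute {q : ℕ} (σ : Equiv.Perm (Fin q)) (x : EuclideanSpace ℝ (Fin q)) :
    EuclideanSpace ℝ (Fin q) := WithLp.toLp 2 fun i => x (σ i)

/-- `Π(x)`, the set of all permutations of the vector `x`. -/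
def permSet {q : ℕ} (x : EuclideanSpace ℝ (Fin q)) : Set (EuclideanSpace ℝ (Fin q)) :=
  Set.range fun σ : Equiv.Perm (Fin q) => permute σ x

/-- The `0`-centred sphere of radius `ρ` in the sum-zero hyperplane (a `(q-2)`-sphere). -/
def zeroSphere (q : ℕ) (ρ : ℝ) : Set (EuclideanSpace ℝ (Fin q)) :=
  {v | v ∈ sumZero q ∧ ‖v‖ = ρ}

/-- The uniform distribution on the unit sphere of a Euclidean space `E`, as a measure on `E`:
the surface measure divided by its total mass. -/
def unitSphereUniform (E : Type*) [NormedAddCommGroup E] [InnerProductSpace ℝ E]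
    [FiniteDimensional ℝ E] [MeasurableSpace E] [BorelSpace E] : Measure E :=
  (((volume : Measure E).toSphere Set.univ)⁻¹ • (volume : Measure E).toSphere).map Subtype.val

/-- The (continuous) uniform distribution on `zeroSphere q ρ`, as a measure on `ℝ^q`. -/
def sphereUniform (q : ℕ) (ρ : ℝ) : Measure (EuclideanSpace ℝ (Fin q)) :=
  (unitSphereUniform (sumZero q)).map fun u : sumZero q => ρ • (u : EuclideanSpace ℝ (Fin q))

/-- The open spherical cap `C(w; t)`, for `w` in the sum-zero hyperplane. -/
def cap {q : ℕ} (w : EuclideanSpace ℝ (Fin q)) (t : ℝ) : Set (EuclideanSpace ℝ (Fin q)) :=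
  {v | v ∈ zeroSphere q ‖w‖ ∧ ‖w‖ ^ 2 * t < inner ℝ v w}

/-- The set of all open spherical caps of `zeroSphere q ρ`. -/
def caps (q : ℕ) (ρ : ℝ) : Set (Set (EuclideanSpace ℝ (Fin q))) :=
  {C | ∃ w ∈ zeroSphere q ρ, ∃ t : ℝ, -1 ≤ t ∧ t < 1 ∧ C = cap w t}

/-- The normalized spherical cap discrepancy of a finite nonempty subset `N` of
`zeroSphere q ρ`. -/
def capDiscrepancy {q : ℕ} (ρ : ℝ) (N : Set (EuclideanSpace ℝ (Fin q))) : ℝ :=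
  sSup ((fun C => |(uniformOn N).real C - (sphereUniform q ρ).real C|) '' caps q ρ)

/-- Asymptotic permutation-uniformity of a sequence of (nonzero) vectors `y^q` with coordinate
sum zero and nondecreasing coordinates. -/
def IsAPU (y : (q : ℕ) → EuclideanSpace ℝ (Fin q)) : Prop :=
  Tendsto (fun q => capDiscrepancy ‖y q‖ (permSet (y q))) atTop (𝓝 0)

/-- Asymptotic permutation-uniformity of a sequence of vectors `x^q` of `ℝ^q` whose coordinate sum
need not vanish. Here `Π(x^q)` lies in a `(q-2)`-sphere that is centred at `x̄^q e`; both are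
translated by `-x̄^q e` (see `permSet_center`), which takes `Π(x^q)` to `Π(x^q - x̄^q e)`. -/
def IsAPUCentered (x : (q : ℕ) → EuclideanSpace ℝ (Fin q)) : Prop :=
  IsAPU fun q => center (x q)

/-- `b_k^q = √(3 k (q - k) / (q (q + 1)))`. -/
def bCoeff (q k : ℕ) : ℝ := √(3 * k * ((q : ℝ) - k) / (q * ((q : ℝ) + 1)))

/-- The vector with coordinates `b_{k-1}^q - b_k^q`, `k = 1, …, q`
(the index `i : Fin q` stands for `k = i + 1`). -/
def aVec (q : ℕ) : EuclideanSpace ℝ (Fin q) :=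
  WithLp.toLp 2 fun i => bCoeff q i - bCoeff q (i + 1)

/-- The maximal configuration with coordinate sum zero. -/
def maxConfig (q : ℕ) : EuclideanSpace ℝ (Fin q) :=
  (√(q * ((q : ℝ) ^ 2 - 1) / 12) / ‖aVec q‖) • aVec q

/-- The maximal configuration with coordinate average `(q + 1) / 2`. -/
def maxConfigShifted (q : ℕ) : EuclideanSpace ℝ (Fin q) :=
  maxConfig q + (((q : ℝ) + 1) / 2) • ones q

/-- The law of `(√q / ‖y‖) Y_i`, where `Y` is uniformly distributed on `Π(y)`. -/
def stdMarginal {q : ℕ} (y : EuclideanSpace ℝ (Fin q)) (i : Fin q) : Measure ℝ :=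
  (uniformOn (permSet y)).map fun v => √q / ‖y‖ * v i

/-- For a fixed coordinate index `i = 0, 1, …`, the sequence (in `q`) of the laws of the
standardized `i`-th coordinate; for the finitely many `q ≤ i`, where there is no such coordinate,
the value is irrelevant and set to a point mass. -/
def stdMarginals (y : (q : ℕ) → EuclideanSpace ℝ (Fin q)) (i q : ℕ) : Measure ℝ :=
  if h : i < q then stdMarginal (y q) ⟨i, h⟩ else Measure.dirac 0

/-- Random variables `X_q` with laws `μ q` satisfy `X_q = O_p(r q)`. -/
def IsBigOInProb (μ : ℕ → Measure ℝ) (r : ℕ → ℝ) : Prop :=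
  ∀ ε > 0, ∃ M > 0, ∀ᶠ q in atTop, (μ q).real {x | M * r q < |x|} < ε

/-- Random variables with laws `μ q` tend to zero in probability. -/
def TendsToZeroInProb (μ : ℕ → Measure ℝ) : Prop :=
  ∀ ε > 0, Tendsto (fun q => (μ q).real {x | ε < |x|}) atTop (𝓝 0)

/-- Convergence in distribution: the distribution functions converge at every point at which the
limiting distribution has no atom. -/
def ConvergesInDistribution (μ : ℕ → Measure ℝ) (ν : Measure ℝ) : Prop :=
  ∀ x : ℝ, ν {x} = 0 → Tendsto (fun q => (μ q).real (Set.Iic x)) atTop (𝓝 (ν.real (Set.Iic x)))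

/-- `Π(x - x̄ e)` is the translate of `Π(x)` by `-x̄ e`. -/
theorem permSet_center {q : ℕ} (x : EuclideanSpace ℝ (Fin q)) :
    permSet (center x) = (fun v => v - ((∑ i, x i) / q) • ones q) '' permSet x := by
  unfold permSet
  rw [← Set.range_comp]
  rfl

end

end PermUniform

/-! Caps centred at the projection of a basis vector are half-spaces in a single coordinate, so the
cap discrepancy bounds the distance between the distribution functions of the standardized
coordinate of a random permutation and of a uniform point on the sphere
(`abs_stdMarginal_Iic_sub_le`). The latter tends to N(0,1) by Maxwell–Poincaré: a uniform point is a
normalized Gaussian vector, and the strong law controls its norm. So APU forces normal marginals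
(`IsAPU.convergesInDistribution`).

For the maximal configuration, a coordinate of a random permutation is uniform over the coordinates
of `aVec`, up to scale, and Markov's inequality reduces everything to comparing ℓ¹ and ℓ² norms. The
numbers b_k rise from 0 to at most 1 and fall back to 0, so the ℓ¹ norm is at most 2. Near the left
end b_k behaves like √(3k/q), so the squared increments are of order 1/(kq) and the squared ℓ² norm
is at least a constant times (log q)/q. The standardized coordinate is thus O_p(1/√log q), which
rules out a normal limit. -/

namespace PermUniform

/-! ### Gaussian vectors and the uniform distribution on the sphere. -/

/-- A finite product of standard Gaussian measures has the product density. -/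
theorem pi_gaussianReal_eq_withDensity (ι : Type*) [Fintype ι] :
    Measure.pi (fun _ : ι => gaussianReal 0 1) =
      (volume : Measure (ι → ℝ)).withDensity
        fun g => ENNReal.ofReal (∏ i, gaussianPDFReal 0 1 (g i)) := by
  refine (Measure.pi_eq fun s hs => ?_)
  -- On a box the restricted density is a product of one-variable functions, so its integral
  -- factors.
  have hprod : ∀ g : ι → ℝ, (Set.univ.pi s).indicator (fun g => ∏ i, gaussianPDFReal 0 1 (g i)) g =
      ∏ i, (s i).indicator (gaussianPDFReal 0 1) (g i) := by
    intro g
    by_cases hg : g ∈ Set.univ.pi s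
    · rw [Set.indicator_of_mem hg]
      exact Finset.prod_congr rfl fun i _ => (Set.indicator_of_mem (hg i trivial) _).symm
    · rw [Set.indicator_of_notMem hg]
      simp only [Set.mem_pi, Set.mem_univ, true_imp_iff, not_forall] at hg
      obtain ⟨i, hi⟩ := hg
      exact (Finset.prod_eq_zero (Finset.mem_univ i) (Set.indicator_of_notMem hi _)).symm
  have hint : ∀ i, Integrable ((s i).indicator (gaussianPDFReal 0 1)) := fun i =>
    (integrable_gaussianPDFReal 0 1).indicator (hs i)
  rw [withDensity_apply _ (MeasurableSet.univ_pi hs), ← lintegral_indicator (MeasurableSet.univ_pi hs)]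
  have h1 : ∀ g : ι → ℝ, (Set.univ.pi s).indicator
      (fun g => ENNReal.ofReal (∏ i, gaussianPDFReal 0 1 (g i))) g =
      ENNReal.ofReal (∏ i, (s i).indicator (gaussianPDFReal 0 1) (g i)) := by
    intro g
    rw [← hprod]
    by_cases hg : g ∈ Set.univ.pi s <;> simp [hg]
  have hnn : ∀ i x, 0 ≤ (s i).indicator (gaussianPDFReal 0 1) x := fun i x =>
    Set.indicator_nonneg (fun x _ => gaussianPDFReal_nonneg 0 1 x) x
  simp_rw [h1]
  rw [volume_pi, ← ofReal_integral_eq_lintegral_ofReal (Integrable.fintype_prod hint)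
    (Eventually.of_forall fun g => Finset.prod_nonneg fun i _ => hnn i _)]
  rw [integral_fintype_prod_eq_prod (fun i => (s i).indicator (gaussianPDFReal 0 1)),
    ENNReal.ofReal_prod_of_nonneg fun i _ => integral_nonneg (hnn i)]
  refine Finset.prod_congr rfl fun i _ => ?_
  rw [gaussianReal_apply_eq_integral 0 one_ne_zero, integral_indicator (hs i)]

section Sphere

variable {E : Type*} [NormedAddCommGroup E] [InnerProductSpace ℝ E] [FiniteDimensional ℝ E]
  [MeasurableSpace E] [BorelSpace E]

/-- The density of the standard Gaussian measure depends only on the norm. -/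
theorem stdGaussian_eq_withDensity :
    stdGaussian E = (volume : Measure E).withDensity fun x =>
      ENNReal.ofReal ((√(2 * Real.pi))⁻¹ ^ Module.finrank ℝ E * Real.exp (-‖x‖ ^ 2 / 2)) := by
  let b := stdOrthonormalBasis ℝ E
  let T : (Fin (Module.finrank ℝ E) → ℝ) ≃ᵐ E :=
    (MeasurableEquiv.toLp 2 _).trans b.measurableEquiv.symm
  have hT : MeasurePreserving T := by
    refine (PiLp.volume_preserving_toLp _).trans ?_
    exact b.measurePreserving_measurableEquiv.symm
  have hTapp : ∀ g, T g = ∑ i, g i • b i := by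
    intro g
    exact (b.sum_repr_symm (WithLp.toLp 2 g)).symm
  have hnorm : ∀ g, ‖T g‖ ^ 2 = ∑ i, g i ^ 2 := by
    intro g
    have : ‖T g‖ = ‖(WithLp.toLp 2 g : EuclideanSpace ℝ (Fin (Module.finrank ℝ E)))‖ :=
      b.repr.symm.norm_map _
    rw [this, EuclideanSpace.norm_sq_eq]
    simp
  have h1 : stdGaussian E = (Measure.pi fun _ => gaussianReal 0 1).map T := by
    rw [stdGaussian_eq_map_pi_orthonormalBasis b]
    congr 1
    ext g
    rw [hTapp]
  rw [h1, pi_gaussianReal_eq_withDensity]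
  ext s hs
  rw [T.map_apply, withDensity_apply _ hs, withDensity_apply _ (T.measurable hs),
    ← hT.setLIntegral_comp_preimage_emb T.measurableEmbedding]
  refine lintegral_congr fun g => ?_
  rw [neg_div, hnorm]
  simp only [gaussianPDFReal, NNReal.coe_one, mul_one, sub_zero, Finset.prod_mul_distrib,
    Finset.prod_const, Finset.card_univ, Fintype.card_fin, ← Real.exp_sum, neg_div,
    Finset.sum_neg_distrib, Finset.sum_div]

/-- Integration in polar coordinates of a product of an angular and a radial function. -/
theorem lintegral_polar [Nontrivial E] {f : E → ENNReal} (hf : Measurable f)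
    {h : ℝ → ENNReal} (hh : Measurable h) :
    ∫⁻ x : E, f (‖x‖⁻¹ • x) * h ‖x‖ =
      (∫⁻ s, f s ∂(volume : Measure E).toSphere) *
        ∫⁻ r : Set.Ioi (0 : ℝ), h r ∂(Measure.volumeIoiPow (Module.finrank ℝ E - 1)) := by
  calc ∫⁻ x : E, f (‖x‖⁻¹ • x) * h ‖x‖
      = ∫⁻ x : ({0}ᶜ : Set E), f (‖x.1‖⁻¹ • x.1) * h ‖x.1‖ ∂(volume.comap Subtype.val) := by
        rw [lintegral_subtype_comap (measurableSet_singleton _).compl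
          (fun x : E => f (‖x‖⁻¹ • x) * h ‖x‖), restrict_compl_singleton]
    _ = ∫⁻ p : Metric.sphere (0 : E) 1 × Set.Ioi (0 : ℝ), f p.1 * h p.2
          ∂((volume : Measure E).toSphere.prod
            (Measure.volumeIoiPow (Module.finrank ℝ E - 1))) := by
        rw [← (volume : Measure E).measurePreserving_homeomorphUnitSphereProd.lintegral_comp_emb
          (Homeomorph.measurableEmbedding _)]
        simp
    _ = _ := lintegral_prod_mul (f := fun s : Metric.sphere (0 : E) 1 => f s)
        (g := fun r : Set.Ioi (0 : ℝ) => h r) (by fun_prop) (by fun_prop)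

/-- The normalization of a standard Gaussian vector is uniformly distributed on the sphere. -/
theorem unitSphereUniform_eq_map_stdGaussian [Nontrivial E] :
    unitSphereUniform E = (stdGaussian E).map fun x => ‖x‖⁻¹ • x := by
  set d : ℝ → ENNReal := fun r =>
    ENNReal.ofReal ((√(2 * Real.pi))⁻¹ ^ Module.finrank ℝ E * Real.exp (-r ^ 2 / 2)) with hd
  have hdm : Measurable d := by fun_prop
  have hnm : Measurable fun x : E => ‖x‖⁻¹ • x := by fun_prop
  set c := ∫⁻ r : Set.Ioi (0 : ℝ), d r ∂(Measure.volumeIoiPow (Module.finrank ℝ E - 1))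
  have key : ∀ s : Set E, MeasurableSet s →
      (stdGaussian E).map (fun x => ‖x‖⁻¹ • x) s =
        (volume : Measure E).toSphere (Subtype.val ⁻¹' s) * c := by
    intro s hs
    have hs' : MeasurableSet (Subtype.val ⁻¹' s : Set (Metric.sphere (0 : E) 1)) :=
      measurable_subtype_coe hs
    rw [Measure.map_apply hnm hs, stdGaussian_eq_withDensity, withDensity_apply _ (hnm hs),
      ← lintegral_indicator (hnm hs)]
    have := lintegral_polar (f := s.indicator (1 : E → ENNReal))
      (measurable_one.indicator hs) hdm
    have h2 : ∫⁻ u : Metric.sphere (0 : E) 1, s.indicator (1 : E → ENNReal) u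
        ∂(volume : Measure E).toSphere = (volume : Measure E).toSphere (Subtype.val ⁻¹' s) := by
      rw [← lintegral_indicator_one hs']
      rfl
    rw [h2] at this
    rw [← this]
    refine lintegral_congr fun x => ?_
    by_cases hx : ‖x‖⁻¹ • x ∈ s
    · rw [Set.indicator_of_mem (by exact hx), Set.indicator_of_mem hx]
      simp [hd]
    · rw [Set.indicator_of_notMem (by exact hx), Set.indicator_of_notMem hx]
      simp
  -- The radial integral `c` is never computed: total mass 1 determines it.
  have hone : (volume : Measure E).toSphere Set.univ * c = 1 := by
    have := key Set.univ .univ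
    rw [Measure.map_apply hnm .univ, Set.preimage_univ, measure_univ, Set.preimage_univ] at this
    exact this.symm
  have hc : c = ((volume : Measure E).toSphere Set.univ)⁻¹ :=
    ENNReal.eq_inv_of_mul_eq_one_left (by rwa [mul_comm])
  ext s hs
  rw [key s hs, hc, unitSphereUniform, Measure.map_apply measurable_subtype_coe hs,
    Measure.smul_apply, smul_eq_mul, mul_comm]

/-! ### Maxwell–Poincaré and Gaussian cones. -/

/-- The Maxwell–Poincaré lemma on the probability space of an i.i.d. standard Gaussian sequence. -/
theorem tendsto_measure_infinitePi_gaussian (x : ℝ) :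
    Tendsto (fun n : ℕ => (Measure.infinitePi fun _ : ℕ => gaussianReal 0 1).real
      {ω | x / √n * √(∑ i ∈ Finset.range n, ω i ^ 2) < ω 0}) atTop
      (𝓝 ((gaussianReal 0 1).real (Set.Ioi x))) := by
  set P := Measure.infinitePi fun _ : ℕ => gaussianReal 0 1 with hP
  have hlaw : ∀ i, P.map (fun ω : ℕ → ℝ => ω i) = gaussianReal 0 1 := fun i =>
    Measure.infinitePi_map_eval _ i
  have hsq : ∫ z, z ^ 2 ∂gaussianReal 0 1 = 1 := by
    have h := variance_fun_id_gaussianReal (μ := 0) (v := 1)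
    rw [variance_eq_integral (by fun_prop)] at h
    simpa [integral_id_gaussianReal] using h
  have hsqint : Integrable (fun z : ℝ => z ^ 2) (gaussianReal 0 1) :=
    (memLp_id_gaussianReal 2).integrable_sq
  have hident : ∀ i, IdentDistrib (fun ω : ℕ → ℝ => ω i ^ 2) (fun ω => ω 0 ^ 2) P P := by
    intro i
    have : IdentDistrib (fun ω : ℕ → ℝ => ω i) (fun ω => ω 0) P P :=
      ⟨(measurable_pi_apply i).aemeasurable, (measurable_pi_apply 0).aemeasurable,
        by rw [hlaw, hlaw]⟩
    exact this.comp (measurable_id.pow_const 2)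
  have hmean : ∫ ω, ω 0 ^ 2 ∂P = 1 := by
    rw [← hsq, ← hlaw 0, integral_map (measurable_pi_apply 0).aemeasurable (by fun_prop)]
  have hint : Integrable (fun ω : ℕ → ℝ => ω 0 ^ 2) P := by
    rw [← hlaw 0] at hsqint
    exact hsqint.comp_measurable (by fun_prop)
  have hindep : iIndepFun (fun (i : ℕ) (ω : ℕ → ℝ) => ω i ^ 2) P :=
    iIndepFun_infinitePi (P := fun _ : ℕ => gaussianReal 0 1)
      (X := fun _ z => z ^ 2) (fun _ => by fun_prop)
  have hlln := strong_law_ae_real (fun (i : ℕ) (ω : ℕ → ℝ) => ω i ^ 2) hint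
    (fun i j hij => hindep.indepFun hij) hident
  -- The indicators can fail to converge only on the boundary `ω 0 = x`, a null set.
  have hne : ∀ᵐ ω ∂P, ω 0 ≠ x := by
    have h0 : gaussianReal 0 1 {x} = 0 := by
      have := nullSingletonClass_gaussianReal (μ := 0) (v := 1) one_ne_zero
      exact measure_singleton x
    rw [← hlaw 0, Measure.map_apply (by fun_prop) (measurableSet_singleton x)] at h0
    exact measure_eq_zero_iff_ae_notMem.1 h0
  have hlim : P.real {ω | x < ω 0} = (gaussianReal 0 1).real (Set.Ioi x) := by
    rw [← hlaw 0, map_measureReal_apply (by fun_prop) measurableSet_Ioi]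
    rfl
  rw [← hlim]
  refine (ENNReal.tendsto_toReal (measure_ne_top _ _)).comp ?_
  refine tendsto_measure_of_ae_tendsto_indicator_of_isFiniteMeasure atTop
    (measurableSet_lt measurable_const (by fun_prop))
    (fun n => measurableSet_lt (by fun_prop) (by fun_prop)) ?_
  filter_upwards [hlln, hne] with ω hω hx
  rw [hmean] at hω
  have hconv : Tendsto (fun n : ℕ => x / √n * √(∑ i ∈ Finset.range n, ω i ^ 2)) atTop (𝓝 x) := by
    have h1 := (Real.continuous_sqrt.tendsto _).comp hω
    rw [Real.sqrt_one] at h1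
    have h2 := h1.const_mul x
    rw [mul_one] at h2
    refine h2.congr fun n => ?_
    simp only [Function.comp]
    rw [Real.sqrt_div (Finset.sum_nonneg fun i _ => sq_nonneg _)]
    ring
  rcases lt_or_gt_of_ne hx with h | h
  · filter_upwards [hconv.eventually (lt_mem_nhds h)] with n hn
    exact iff_of_false (not_lt.2 hn.le) (not_lt.2 h.le)
  · filter_upwards [hconv.eventually (gt_mem_nhds h)] with n hn
    exact iff_of_true hn h

/-- The Gaussian measure of a circular cone with axis `u`, in terms of an i.i.d. sequence. -/
theorem stdGaussian_real_cone {m : ℕ} (hm : Module.finrank ℝ E = m + 1) {u : E} (hu : ‖u‖ = 1)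
    (t : ℝ) :
    (stdGaussian E).real {x | t * ‖x‖ < inner ℝ x u} =
      (Measure.infinitePi fun _ : ℕ => gaussianReal 0 1).real
        {ω | t * √(∑ i ∈ Finset.range (m + 1), ω i ^ 2) < ω 0} := by
  -- In a basis starting with `u` the cone involves only the first coordinate and the norm. Drawing
  -- the coordinates from one infinite sequence puts all dimensions on the same probability space,
  -- as the strong law requires.
  obtain ⟨b, hb⟩ : ∃ b : OrthonormalBasis (Fin (m + 1)) ℝ E, b 0 = u := by
    have hv : Orthonormal ℝ (({0} : Set (Fin (m + 1))).domRestrict fun _ => u) := by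
      refine ⟨fun i => hu, fun i j hij => (hij (Subsingleton.elim _ _)).elim⟩
    obtain ⟨b, hb⟩ := hv.exists_orthonormalBasis_extension_of_card_eq (by simp [hm])
    exact ⟨b, hb 0 rfl⟩
  let R : (ℕ → ℝ) → E := fun ω => ∑ i : Fin (m + 1), ω i • b i
  have hR : Measurable R := by fun_prop
  have hmap : stdGaussian E = (Measure.infinitePi fun _ : ℕ => gaussianReal 0 1).map R := by
    have hpi : (Measure.infinitePi fun _ : ℕ => gaussianReal 0 1).map
        (fun ω (i : Fin (m + 1)) => ω i) = Measure.pi fun _ => gaussianReal 0 1 := by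
      rw [← Measure.infinitePi_eq_pi]
      exact Measure.map_infinitePi_infinitePi_of_inj (f := fun i : Fin (m + 1) => (i : ℕ))
        Fin.val_injective
    rw [stdGaussian_eq_map_pi_orthonormalBasis b, ← hpi,
      Measure.map_map (by fun_prop) (by fun_prop)]
    rfl
  rw [hmap, map_measureReal_apply hR (measurableSet_lt (by fun_prop) (by fun_prop))]
  congr 1
  ext ω
  have h1 : inner ℝ (R ω) u = ω 0 := by
    have := b.orthonormal.inner_left_fintype (fun i : Fin (m + 1) => ω i) 0
    rw [hb] at this
    simpa using this
  have h2 : ‖R ω‖ = √(∑ i ∈ Finset.range (m + 1), ω i ^ 2) := by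
    have h3 : R ω = b.repr.symm (WithLp.toLp 2 fun i : Fin (m + 1) => ω i) :=
      b.sum_repr_symm (WithLp.toLp 2 fun i : Fin (m + 1) => ω i)
    rw [h3, LinearIsometryEquiv.norm_map, EuclideanSpace.norm_eq,
      Finset.sum_range fun i => ω i ^ 2]
    simp
  simp [h1, h2]

end Sphere

/-! ### Random permutations and their coordinates. -/

theorem mem_sumZero {q : ℕ} {v : EuclideanSpace ℝ (Fin q)} : v ∈ sumZero q ↔ ∑ i, v i = 0 := by
  rw [sumZero, Submodule.mem_orthogonal_singleton_iff_inner_right]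
  simp [ones, PiLp.inner_apply]

theorem finrank_sumZero (m : ℕ) : Module.finrank ℝ (sumZero (m + 1)) = m := by
  have : Fact (Module.finrank ℝ (EuclideanSpace ℝ (Fin (m + 1))) = m + 1) := ⟨by simp⟩
  refine Submodule.finrank_orthogonal_span_singleton fun h => ?_
  have := congrArg (fun v => v 0) h
  simp [ones] at this

theorem permSet_finite {q : ℕ} (y : EuclideanSpace ℝ (Fin q)) : (permSet y).Finite :=
  Set.finite_range _

theorem permSet_nonempty {q : ℕ} (y : EuclideanSpace ℝ (Fin q)) : (permSet y).Nonempty :=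
  Set.range_nonempty _

theorem isProbabilityMeasure_uniformOn_permSet {q : ℕ} (y : EuclideanSpace ℝ (Fin q)) :
    IsProbabilityMeasure (uniformOn (permSet y)) :=
  isProbabilityMeasure_uniformOn (permSet_finite y) (permSet_nonempty y)

theorem norm_of_mem_permSet {q : ℕ} {y v : EuclideanSpace ℝ (Fin q)} (hv : v ∈ permSet y) :
    ‖v‖ = ‖y‖ := by
  obtain ⟨σ, rfl⟩ := hv
  rw [EuclideanSpace.norm_eq, EuclideanSpace.norm_eq]
  congr 1
  exact Equiv.sum_comp σ fun i => ‖y i‖ ^ 2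

theorem sum_of_mem_permSet {q : ℕ} {y v : EuclideanSpace ℝ (Fin q)} (hv : v ∈ permSet y) :
    ∑ i, v i = ∑ i, y i := by
  obtain ⟨σ, rfl⟩ := hv
  exact Equiv.sum_comp σ fun i => y i

theorem permute_mem_permSet {q : ℕ} {y v : EuclideanSpace ℝ (Fin q)} (hv : v ∈ permSet y)
    (τ : Equiv.Perm (Fin q)) : permute τ v ∈ permSet y := by
  obtain ⟨σ, rfl⟩ := hv
  exact ⟨σ * τ, rfl⟩

theorem uniformOn_real_apply {Ω : Type*} [MeasurableSpace Ω] [MeasurableSingletonClass Ω]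
    (S : Finset Ω) (p : Ω → Prop) [DecidablePred p] :
    (uniformOn (S : Set Ω)).real {x | p x} = (S.filter p).card / S.card := by
  have h : (S : Set Ω) ∩ {x | p x} = (S.filter p : Finset Ω) := by ext; simp
  rw [measureReal_def, uniformOn, cond_apply S.measurableSet, h, Measure.count_apply_finset,
    Measure.count_apply_finset]
  simp [div_eq_inv_mul]

/-- Each coordinate of a uniform random permutation of `y` is uniform over the coordinates of
`y`. -/
theorem uniformOn_permSet_real_coord {q : ℕ} (y : EuclideanSpace ℝ (Fin q)) (i : Fin q)
    (p : ℝ → Prop) [DecidablePred p] :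
    (uniformOn (permSet y)).real {v | p (v i)} =
      (Finset.univ.filter fun j => p (y j)).card / q := by
  classical
  obtain ⟨S, hS⟩ := (permSet_finite y).exists_finset_coe
  have hmem : ∀ v, v ∈ S ↔ v ∈ permSet y := fun v => by rw [← hS, Finset.mem_coe]
  have hSpos : 0 < S.card := by
    obtain ⟨v, hv⟩ := permSet_nonempty y
    exact Finset.card_pos.2 ⟨v, (hmem v).2 hv⟩
  -- Swapping coordinates `i` and `j` is an involution of Π(y). Counting in the set Π(y), rather
  -- than over permutations, avoids multiplicities from equal coordinates.
  have hsymm : ∀ j, (S.filter fun v => p (v j)).card = (S.filter fun v => p (v i)).card := by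
    intro j
    refine Finset.card_bij' (fun v _ => permute (Equiv.swap i j) v)
      (fun v _ => permute (Equiv.swap i j) v) ?_ ?_ ?_ ?_
    · intro v hv
      simp only [Finset.mem_filter, hmem] at hv ⊢
      exact ⟨permute_mem_permSet hv.1 _, by simpa [permute] using hv.2⟩
    · intro v hv
      simp only [Finset.mem_filter, hmem] at hv ⊢
      exact ⟨permute_mem_permSet hv.1 _, by simpa [permute] using hv.2⟩
    · intro v _
      ext k
      simp [permute]
    · intro v _
      ext k
      simp [permute]
  have hcount : ∀ v ∈ S, (Finset.univ.filter fun j => p (v j)).card =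
      (Finset.univ.filter fun j => p (y j)).card := by
    intro v hv
    obtain ⟨σ, rfl⟩ := (hmem v).1 hv
    exact Finset.card_equiv σ fun j => by
      rw [Finset.mem_filter, Finset.mem_filter]
      exact and_congr (by simp) Iff.rfl
  -- Double counting of the pairs (j, v) with `p (v j)`.
  have hdouble : ∑ j, (S.filter fun v => p (v j)).card =
      ∑ v ∈ S, (Finset.univ.filter fun j => p (v j)).card := by
    simp only [Finset.card_filter]
    exact Finset.sum_comm
  rw [Finset.sum_congr rfl hcount, Finset.sum_congr rfl fun j _ => hsymm j] at hdouble
  simp only [Finset.sum_const, Finset.card_univ, Fintype.card_fin, smul_eq_mul] at hdouble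
  rw [← hS, uniformOn_real_apply S fun v => p (v i)]
  have hq : (0 : ℝ) < q := by exact_mod_cast i.pos
  have hd : (q : ℝ) * (S.filter fun v => p (v i)).card =
      S.card * (Finset.univ.filter fun j => p (y j)).card := by exact_mod_cast hdouble
  have : (0 : ℝ) < S.card := by exact_mod_cast hSpos
  field_simp
  linarith

theorem stdMarginal_real {q : ℕ} (y : EuclideanSpace ℝ (Fin q)) (i : Fin q) {B : Set ℝ}
    (hB : MeasurableSet B) :
    (stdMarginal y i).real B = (uniformOn (permSet y)).real {v | √q / ‖y‖ * v i ∈ B} := by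
  rw [stdMarginal, map_measureReal_apply (by fun_prop) hB]
  rfl

/-! ### Caps about coordinate axes and normality of APU marginals. -/

theorem isProbabilityMeasure_sphereUniform (m : ℕ) (ρ : ℝ) :
    IsProbabilityMeasure (sphereUniform (m + 2) ρ) := by
  have : Nontrivial (sumZero (m + 2)) :=
    Module.nontrivial_of_finrank_pos (R := ℝ) (by rw [finrank_sumZero]; omega)
  have : IsProbabilityMeasure (unitSphereUniform (sumZero (m + 2))) := by
    rw [unitSphereUniform_eq_map_stdGaussian]
    exact Measure.isProbabilityMeasure_map (by fun_prop)
  exact Measure.isProbabilityMeasure_map (by fun_prop)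

/-- The uniform measure of a spherical cap in terms of an i.i.d. Gaussian sequence. -/
theorem sphereUniform_real_cap {m : ℕ} {u : EuclideanSpace ℝ (Fin (m + 2))}
    (hu : u ∈ sumZero (m + 2)) (hu1 : ‖u‖ = 1) {ρ : ℝ} (hρ : 0 < ρ) (t : ℝ) :
    (sphereUniform (m + 2) ρ).real (cap (ρ • u) t) =
      (Measure.infinitePi fun _ : ℕ => gaussianReal 0 1).real
        {ω | t * √(∑ i ∈ Finset.range (m + 1), ω i ^ 2) < ω 0} := by
  have : Nontrivial (sumZero (m + 2)) :=
    Module.nontrivial_of_finrank_pos (R := ℝ) (by rw [finrank_sumZero]; omega)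
  have hw : ‖ρ • u‖ = ρ := by rw [norm_smul, hu1, mul_one, Real.norm_of_nonneg hρ.le]
  have hcap : MeasurableSet (cap (ρ • u) t) := by
    have h1 : MeasurableSet (sumZero (m + 2) : Set (EuclideanSpace ℝ (Fin (m + 2)))) :=
      (Submodule.closed_of_finiteDimensional _).measurableSet
    have h2 : MeasurableSet {v : EuclideanSpace ℝ (Fin (m + 2)) | ‖v‖ = ‖ρ • u‖} :=
      measurableSet_eq_fun measurable_norm measurable_const
    have h3 : MeasurableSet {v : EuclideanSpace ℝ (Fin (m + 2)) |
        ‖ρ • u‖ ^ 2 * t < inner ℝ v (ρ • u)} := measurableSet_lt (by fun_prop) (by fun_prop)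
    exact (h1.inter h2).inter h3
  rw [sphereUniform, map_measureReal_apply (by fun_prop) hcap,
    unitSphereUniform_eq_map_stdGaussian, map_measureReal_apply (by fun_prop)
      ((by fun_prop : Measurable fun u : sumZero (m + 2) =>
        ρ • (u : EuclideanSpace ℝ (Fin (m + 2)))) hcap),
    ← stdGaussian_real_cone (finrank_sumZero (m + 1)) (u := (⟨u, hu⟩ : sumZero (m + 2))) hu1 t]
  congr 1
  ext x
  -- At the origin both conditions fail: the normalized vector is 0, off the sphere, and the cone
  -- inequality is strict.
  rcases eq_or_ne x 0 with rfl | hx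
  · simp [cap, zeroSphere, hw, hρ.ne]
  have hx' : 0 < ‖x‖ := norm_pos_iff.2 hx
  have hn : ‖ρ • ((‖x‖⁻¹ • x : sumZero (m + 2)) : EuclideanSpace ℝ (Fin (m + 2)))‖ = ρ := by
    rw [norm_smul, Submodule.norm_coe, norm_smul, norm_inv, norm_norm,
      inv_mul_cancel₀ hx'.ne', mul_one, Real.norm_of_nonneg hρ.le]
  have hin : inner ℝ (ρ • ((‖x‖⁻¹ • x : sumZero (m + 2)) : EuclideanSpace ℝ (Fin (m + 2))))
      (ρ • u) = ρ ^ 2 * (‖x‖⁻¹ * inner ℝ x (⟨u, hu⟩ : sumZero (m + 2))) := by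
    rw [inner_smul_left, inner_smul_right, Submodule.coe_smul, inner_smul_left,
      Submodule.coe_inner]
    simp
    ring
  have hm : ρ • ((‖x‖⁻¹ • x : sumZero (m + 2)) : EuclideanSpace ℝ (Fin (m + 2))) ∈
      sumZero (m + 2) := Submodule.smul_mem _ _ (Submodule.coe_mem _)
  simp only [Set.mem_preimage, cap, zeroSphere, Set.mem_ofPred_eq, hw, hn, hin, hm, true_and,
    and_self]
  rw [mul_lt_mul_iff_right₀ (by positivity), inv_mul_eq_div, lt_div_iff₀ hx']

/-- The unit vector in the direction of the projection of the `i`-th basis vector to the sum-zero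
hyperplane. -/
noncomputable def axis {q : ℕ} (i : Fin q) : EuclideanSpace ℝ (Fin q) :=
  √((q : ℝ) / (q - 1)) • center (EuclideanSpace.single i 1)

theorem center_mem_sumZero {q : ℕ} (x : EuclideanSpace ℝ (Fin q)) : center x ∈ sumZero q := by
  rw [mem_sumZero]
  rcases Nat.eq_zero_or_pos q with rfl | hq
  · simp
  · have : (q : ℝ) ≠ 0 := by positivity
    simp [center, ones, Finset.sum_sub_distrib, mul_div_cancel₀ _ this]

/-- Centring changes the basis vector by a multiple of `ones`, which is orthogonal to `v`. This
turns caps about `axis i` into conditions on `v i`. -/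
theorem inner_center_single {q : ℕ} (i : Fin q) {v : EuclideanSpace ℝ (Fin q)}
    (hv : v ∈ sumZero q) : inner ℝ v (center (EuclideanSpace.single i 1)) = v i := by
  have : inner ℝ v (ones q) = 0 := by
    rw [mem_sumZero] at hv
    simpa [ones, PiLp.inner_apply] using hv
  rw [center, inner_sub_right, inner_smul_right, this, EuclideanSpace.inner_single_right]
  simp

theorem norm_axis {q : ℕ} (hq : 2 ≤ q) (i : Fin q) : ‖axis i‖ = 1 := by
  have hq' : (2 : ℝ) ≤ q := by exact_mod_cast hq
  -- The squared norm is the `i`-th coordinate of the centred vector itself, 1 - 1/q.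
  have h : ‖center (EuclideanSpace.single i (1 : ℝ))‖ ^ 2 = (q - 1) / q := by
    rw [← real_inner_self_eq_norm_sq, inner_center_single i (center_mem_sumZero _)]
    simp [center, ones]
    field_simp
  have h2 : ‖axis i‖ ^ 2 = 1 := by
    rw [axis, norm_smul, mul_pow, h, Real.norm_eq_abs, sq_abs, Real.sq_sqrt
      (div_nonneg (by linarith) (by linarith))]
    have : (q : ℝ) - 1 ≠ 0 := by linarith
    field_simp
  exact (pow_eq_one_iff_of_nonneg (norm_nonneg _) two_ne_zero).1 h2

theorem abs_sub_le_capDiscrepancy {m : ℕ} (y : EuclideanSpace ℝ (Fin (m + 2))) (ρ : ℝ)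
    {C : Set (EuclideanSpace ℝ (Fin (m + 2)))} (hC : C ∈ caps (m + 2) ρ) :
    |(uniformOn (permSet y)).real C - (sphereUniform (m + 2) ρ).real C| ≤
      capDiscrepancy ρ (permSet y) := by
  have := isProbabilityMeasure_uniformOn_permSet y
  have := isProbabilityMeasure_sphereUniform m ρ
  -- A real supremum dominates its members only when the set is bounded above; two probabilities
  -- differ by at most 1.
  refine le_csSup ⟨1, ?_⟩ (Set.mem_image_of_mem _ hC)
  rintro _ ⟨C, -, rfl⟩
  have h1 : (uniformOn (permSet y)).real C ≤ 1 := measureReal_le_one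
  have h2 : (sphereUniform (m + 2) ρ).real C ≤ 1 := measureReal_le_one
  have h3 : 0 ≤ (uniformOn (permSet y)).real C := measureReal_nonneg
  have h4 : 0 ≤ (sphereUniform (m + 2) ρ).real C := measureReal_nonneg
  exact abs_le.2 ⟨by linarith, by linarith⟩

/-- The distribution function of a standardized marginal is, up to the cap discrepancy, that of a
coordinate of a uniformly distributed point of the sphere. -/
theorem abs_stdMarginal_Iic_sub_le {m : ℕ} {y : EuclideanSpace ℝ (Fin (m + 2))} (hy : y ≠ 0)
    (hy0 : y ∈ sumZero (m + 2)) (i : Fin (m + 2)) {x : ℝ} (hx : |x| < √((m + 1 : ℕ) : ℝ)) :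
    |(stdMarginal y i).real (Set.Iic x) -
      (1 - (Measure.infinitePi fun _ : ℕ => gaussianReal 0 1).real
        {ω | x / √((m + 1 : ℕ) : ℝ) * √(∑ i ∈ Finset.range (m + 1), ω i ^ 2) < ω 0})| ≤
      capDiscrepancy ‖y‖ (permSet y) := by
  have := isProbabilityMeasure_uniformOn_permSet y
  have hρ : 0 < ‖y‖ := norm_pos_iff.2 hy
  have hs : 0 < √((m + 1 : ℕ) : ℝ) := (abs_nonneg x).trans_lt hx
  have hax := norm_axis (by omega) i
  have haxm : axis i ∈ sumZero (m + 2) := Submodule.smul_mem _ _ (center_mem_sumZero _)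
  set t := x / √((m + 1 : ℕ) : ℝ) with ht
  have hw : ‖‖y‖ • axis i‖ = ‖y‖ := by rw [norm_smul, hax, mul_one, norm_norm]
  -- The assumption on `|x|` places `t` in the admissible range of cap heights.
  have hC : cap (‖y‖ • axis i) t ∈ caps (m + 2) ‖y‖ := by
    refine ⟨‖y‖ • axis i, ⟨Submodule.smul_mem _ _ haxm, hw⟩, t, ?_, ?_, rfl⟩
    · rw [ht, le_div_iff₀ hs]
      linarith [(abs_lt.1 hx).1]
    · rw [ht, div_lt_one hs]
      exact (abs_lt.1 hx).2
  have hle := abs_sub_le_capDiscrepancy y ‖y‖ hC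
  rw [sphereUniform_real_cap haxm hax hρ] at hle
  have hmarg : (stdMarginal y i).real (Set.Iic x) =
      1 - (uniformOn (permSet y)).real (cap (‖y‖ • axis i) t) := by
    rw [stdMarginal_real y i measurableSet_Iic]
    have hms : MeasurableSet {v : EuclideanSpace ℝ (Fin (m + 2)) |
        √(m + 2 : ℕ) / ‖y‖ * v i ∈ Set.Iic x} :=
      (by fun_prop : Measurable fun v : EuclideanSpace ℝ (Fin (m + 2)) =>
        √(m + 2 : ℕ) / ‖y‖ * v i) measurableSet_Iic
    -- The cap and the half-space agree only on the sphere, so both are first intersected with Π(y),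
    -- which carries the measure.
    have hset : (uniformOn (permSet y)).real (cap (‖y‖ • axis i) t) =
        (uniformOn (permSet y)).real {v | √(m + 2 : ℕ) / ‖y‖ * v i ∈ Set.Iic x}ᶜ := by
      rw [measureReal_def, measureReal_def, ← uniformOn_inter_self (permSet_finite y),
        ← uniformOn_inter_self (permSet_finite y) (t := {v | _}ᶜ)]
      congr 2
      ext v
      refine and_congr_right fun hv => ?_
      have hv0 : v ∈ sumZero (m + 2) := by
        rw [mem_sumZero, sum_of_mem_permSet hv]
        exact mem_sumZero.1 hy0
      have hz : v ∈ zeroSphere (m + 2) ‖y‖ :=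
        ⟨hv0, norm_of_mem_permSet hv⟩
      have hin : inner ℝ v (‖y‖ • axis i) = ‖y‖ ^ 2 *
          ((√(m + 2 : ℕ) / ‖y‖ * v i) / √((m + 1 : ℕ) : ℝ)) := by
        rw [axis, inner_smul_right, inner_smul_right, inner_center_single i hv0]
        have h1 : ((m + 2 : ℕ) : ℝ) - 1 = (m + 1 : ℕ) := by push_cast; ring
        rw [h1, Real.sqrt_div (by positivity)]
        field_simp
      simp only [cap, Set.mem_ofPred_eq, hz, true_and, hw, hin, Set.mem_compl_iff, Set.mem_Iic,
        not_le]
      rw [mul_lt_mul_iff_right₀ (by positivity), ht, div_lt_div_iff_of_pos_right hs]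
    rw [hset, probReal_compl_eq_one_sub hms]
    ring
  rw [hmarg]
  rw [abs_sub_comm] at hle
  convert hle using 2
  ring

/-- The standardized coordinates of an APU sequence are asymptotically standard normal. -/
theorem IsAPU.convergesInDistribution {y : (q : ℕ) → EuclideanSpace ℝ (Fin q)}
    (hy : ∀ q, 2 ≤ q → y q ≠ 0 ∧ y q ∈ sumZero q) (h : IsAPU y) (i : ℕ) :
    ConvergesInDistribution (stdMarginals y i) (gaussianReal 0 1) := by
  intro x _
  rw [← tendsto_add_atTop_iff_nat 2]
  have hG : (gaussianReal 0 1).real (Set.Iic x) = 1 - (gaussianReal 0 1).real (Set.Ioi x) := by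
    rw [← Set.compl_Iic, probReal_compl_eq_one_sub measurableSet_Iic]
    ring
  have hlim : Tendsto (fun m : ℕ => 1 - (Measure.infinitePi fun _ : ℕ => gaussianReal 0 1).real
        {ω | x / √((m + 1 : ℕ) : ℝ) * √(∑ i ∈ Finset.range (m + 1), ω i ^ 2) < ω 0}) atTop
      (𝓝 ((gaussianReal 0 1).real (Set.Iic x))) := by
    rw [hG]
    exact ((tendsto_add_atTop_iff_nat 1).2 (tendsto_measure_infinitePi_gaussian x)).const_sub 1
  have hdisc := (tendsto_add_atTop_iff_nat 2).2 h
  have hsqrt : ∀ᶠ m : ℕ in atTop, |x| < √((m + 1 : ℕ) : ℝ) :=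
    ((Real.tendsto_sqrt_atTop.comp tendsto_natCast_atTop_atTop).comp
      (tendsto_add_atTop_nat 1)).eventually_gt_atTop _
  have hdiff : Tendsto (fun m : ℕ => (stdMarginals y i (m + 2)).real (Set.Iic x) -
      (1 - (Measure.infinitePi fun _ : ℕ => gaussianReal 0 1).real
        {ω | x / √((m + 1 : ℕ) : ℝ) * √(∑ i ∈ Finset.range (m + 1), ω i ^ 2) < ω 0})) atTop
      (𝓝 0) := by
    refine squeeze_zero_norm' ?_ hdisc
    filter_upwards [hsqrt, eventually_ge_atTop i] with m hm him
    obtain ⟨h1, h2⟩ := hy (m + 2) (by omega)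
    rw [stdMarginals, dif_pos (by omega)]
    exact abs_stdMarginal_Iic_sub_le h1 h2 _ hm
  simpa using hdiff.add hlim

/-! ### Smallness in probability excludes a normal limit. -/

theorem isFiniteMeasure_stdMarginals (y : (q : ℕ) → EuclideanSpace ℝ (Fin q)) (i q : ℕ) :
    IsFiniteMeasure (stdMarginals y i q) := by
  unfold stdMarginals
  split_ifs
  · have := isProbabilityMeasure_uniformOn_permSet (y q)
    unfold stdMarginal
    infer_instance
  · infer_instance

theorem IsBigOInProb.tendsToZeroInProb {μ : ℕ → Measure ℝ} [∀ q, IsFiniteMeasure (μ q)]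
    {r : ℕ → ℝ} (h : IsBigOInProb μ r) (hr : Tendsto r atTop (𝓝 0)) : TendsToZeroInProb μ := by
  intro ε hε
  refine tendsto_order.2 ⟨fun a ha => Eventually.of_forall fun q =>
    ha.trans_le measureReal_nonneg, fun δ hδ => ?_⟩
  obtain ⟨M, -, hM⟩ := h δ hδ
  have h0 := hr.const_mul M
  rw [mul_zero] at h0
  filter_upwards [hM, h0.eventually (gt_mem_nhds hε)] with q hq hlt
  exact (measureReal_mono fun x (hx : ε < |x|) => hlt.trans hx).trans_lt hq

/-- The distribution functions are compared at -1: the masses of (-∞, -1] vanish in the limit, yet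
N(0,1) charges this half-line because Lebesgue measure is absolutely continuous with respect to it.
-/
theorem TendsToZeroInProb.not_convergesInDistribution_gaussianReal {μ : ℕ → Measure ℝ}
    [∀ q, IsFiniteMeasure (μ q)] (h : TendsToZeroInProb μ) :
    ¬ ConvergesInDistribution μ (gaussianReal 0 1) := by
  intro hc
  have hatom : gaussianReal 0 1 {(-1 : ℝ)} = 0 := by
    have := nullSingletonClass_gaussianReal (μ := 0) (v := 1) one_ne_zero
    exact measure_singleton _
  have hzero : Tendsto (fun q => (μ q).real (Set.Iic (-1))) atTop (𝓝 0) := by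
    refine squeeze_zero (fun q => measureReal_nonneg)
      (fun q => measureReal_mono fun x hx => ?_) (h (1 / 2) one_half_pos)
    have hx' : x ≤ -1 := hx
    show 1 / 2 < |x|
    rw [abs_of_neg (by linarith)]
    linarith
  have heq := tendsto_nhds_unique (hc (-1) hatom) hzero
  rw [measureReal_eq_zero_iff] at heq
  have hv := gaussianReal_absolutelyContinuous' 0 (one_ne_zero : (1 : NNReal) ≠ 0) heq
  simp at hv

/-! ### Norm estimates for `aVec`. -/

theorem bCoeff_nonneg (q k : ℕ) : 0 ≤ bCoeff q k := Real.sqrt_nonneg _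

theorem bCoeff_zero (q : ℕ) : bCoeff q 0 = 0 := by simp [bCoeff]

theorem bCoeff_self (q : ℕ) : bCoeff q q = 0 := by simp [bCoeff]

theorem bCoeff_sq {q k : ℕ} (hk : k ≤ q) :
    bCoeff q k ^ 2 = 3 * k * ((q : ℝ) - k) / (q * ((q : ℝ) + 1)) := by
  have : (k : ℝ) ≤ q := by exact_mod_cast hk
  exact Real.sq_sqrt (div_nonneg (mul_nonneg (by positivity) (by linarith)) (by positivity))

theorem bCoeff_le_one (q k : ℕ) : bCoeff q k ≤ 1 := by
  rw [bCoeff, Real.sqrt_le_iff, one_pow]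
  refine ⟨zero_le_one, ?_⟩
  rcases Nat.eq_zero_or_pos q with rfl | hq
  · simp
  have : (0 : ℝ) < q := by exact_mod_cast hq
  rw [div_le_one (by positivity)]
  nlinarith [sq_nonneg ((q : ℝ) - 2 * k)]

/-- The increment of k(q - k) is q - 2k - 1, which changes sign at the middle. -/
theorem bCoeff_le_succ {q k : ℕ} (h : 2 * k + 1 ≤ q) : bCoeff q k ≤ bCoeff q (k + 1) := by
  have : 2 * (k : ℝ) + 1 ≤ q := by exact_mod_cast h
  refine Real.sqrt_le_sqrt (div_le_div_of_nonneg_right ?_ (by positivity))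
  push_cast
  nlinarith

theorem bCoeff_succ_le {q k : ℕ} (h : q ≤ 2 * k + 1) : bCoeff q (k + 1) ≤ bCoeff q k := by
  have : (q : ℝ) ≤ 2 * (k : ℝ) + 1 := by exact_mod_cast h
  refine Real.sqrt_le_sqrt (div_le_div_of_nonneg_right ?_ (by positivity))
  push_cast
  nlinarith

theorem sum_aVec (q : ℕ) : ∑ i, aVec q i = 0 := by
  have := Finset.sum_range_sub' (bCoeff q) q
  rw [bCoeff_zero, bCoeff_self, sub_zero, Finset.sum_range] at this
  exact this

/-- The sum is the total variation of a unimodal sequence with zero ends, hence twice its peak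
`bCoeff q m`, where `m = q / 2`. -/
theorem sum_abs_aVec_le (q : ℕ) : ∑ i, |aVec q i| ≤ 2 := by
  obtain ⟨m, n, hmn, h1, h2⟩ : ∃ m n, q = m + n ∧ 2 * m ≤ q + 1 ∧ q ≤ 2 * m + 1 :=
    ⟨q / 2, q - q / 2, by omega, by omega, by omega⟩
  have h : ∑ i, |aVec q i| = ∑ k ∈ Finset.range q, |bCoeff q k - bCoeff q (k + 1)| := by
    rw [Finset.sum_range]
    rfl
  have hup : ∑ k ∈ Finset.range m, |bCoeff q k - bCoeff q (k + 1)| = bCoeff q m := by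
    rw [Finset.sum_congr rfl fun k hk => by
      have := Finset.mem_range.1 hk
      rw [abs_of_nonpos (sub_nonpos.2 (bCoeff_le_succ (by omega))), neg_sub],
      Finset.sum_range_sub, bCoeff_zero, sub_zero]
  have hdown : ∑ k ∈ Finset.range n, |bCoeff q (m + k) - bCoeff q (m + k + 1)| = bCoeff q m := by
    rw [Finset.sum_congr rfl fun k _ =>
      abs_of_nonneg (sub_nonneg.2 (bCoeff_succ_le (k := m + k) (by omega)))]
    have := Finset.sum_range_sub' (fun k => bCoeff q (m + k)) n
    rw [← hmn, bCoeff_self, sub_zero] at this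
    exact this
  have hr : Finset.range q = Finset.range (m + n) := by rw [hmn]
  rw [h, hr, Finset.sum_range_add, hup, hdown]
  linarith [bCoeff_le_one q m]

/-- Since v - u = (v² - u²)/(u + v) ≥ (v² - u²)/(2v), it suffices to bound v² - u² below and v²
above, which avoids handling square roots. In the first quarter of the indices q - 2k - 1 ≥ q/2. -/
theorem le_sq_bCoeff_sub {q k : ℕ} (h : 4 * (k + 1) ≤ q) :
    3 / (16 * ((q : ℝ) + 1)) * ((k : ℝ) + 1)⁻¹ ≤ (bCoeff q k - bCoeff q (k + 1)) ^ 2 := by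
  have hq : 4 * ((k : ℝ) + 1) ≤ q := by exact_mod_cast h
  have hk : (0 : ℝ) ≤ k := by positivity
  have hq0 : (0 : ℝ) < q := by linarith
  set u := bCoeff q k
  set v := bCoeff q (k + 1) with hv
  have hu0 : 0 ≤ u := bCoeff_nonneg q k
  have huv : u ≤ v := bCoeff_le_succ (by omega)
  have hv2 : v ^ 2 = 3 * (k + 1) * ((q : ℝ) - (k + 1)) / (q * ((q : ℝ) + 1)) := by
    rw [hv, bCoeff_sq (by omega)]
    push_cast
    rfl
  have hu2 : u ^ 2 = 3 * k * ((q : ℝ) - k) / (q * ((q : ℝ) + 1)) := bCoeff_sq (by omega)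
  have hd : 3 / (2 * ((q : ℝ) + 1)) ≤ v ^ 2 - u ^ 2 := by
    rw [hv2, hu2, ← sub_div, div_le_div_iff₀ (by positivity) (by positivity)]
    nlinarith
  have hvle : v ^ 2 ≤ 3 * (k + 1) / ((q : ℝ) + 1) := by
    rw [hv2, div_le_div_iff₀ (by positivity) (by positivity)]
    have : 0 ≤ 3 * ((k : ℝ) + 1) * (q + 1) * (k + 1) := by positivity
    nlinarith
  have hprod : (3 / (2 * ((q : ℝ) + 1))) ^ 2 ≤ (u - v) ^ 2 * (4 * (3 * (k + 1) / ((q : ℝ) + 1))) :=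
    calc (3 / (2 * ((q : ℝ) + 1))) ^ 2 ≤ (v ^ 2 - u ^ 2) ^ 2 := by gcongr
      _ = (u - v) ^ 2 * (u + v) ^ 2 := by ring
      _ ≤ (u - v) ^ 2 * (4 * v ^ 2) := by
        gcongr
        nlinarith
      _ ≤ _ := by gcongr
  have hpos : 0 < 4 * (3 * ((k : ℝ) + 1) / ((q : ℝ) + 1)) := by positivity
  refine le_of_mul_le_mul_right (le_trans (le_of_eq ?_) hprod) hpos
  field_simp
  norm_num

/-- Summing `le_sq_bCoeff_sub` over the first quarter gives a harmonic sum, at least log(q/4). The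
condition q ≥ 16 makes q/4 ≥ √q, so this is at least (log q)/2; q + 1 ≤ 2q then gives 3/64. -/
theorem log_div_le_norm_aVec_sq {q : ℕ} (hq : 16 ≤ q) :
    3 / 64 * (Real.log q / q) ≤ ‖aVec q‖ ^ 2 := by
  have hq' : (16 : ℝ) ≤ q := by exact_mod_cast hq
  have hsum : ‖aVec q‖ ^ 2 = ∑ k ∈ Finset.range q, (bCoeff q k - bCoeff q (k + 1)) ^ 2 := by
    rw [EuclideanSpace.real_norm_sq_eq, Finset.sum_range]
    rfl
  have hharm : Real.log ((q / 4 : ℕ) + 1 : ℕ) ≤ ∑ k ∈ Finset.range (q / 4), ((k : ℝ) + 1)⁻¹ := by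
    have := log_add_one_le_harmonic (q / 4)
    simpa [harmonic] using this
  have hlog : Real.log q / 2 ≤ Real.log ((q / 4 : ℕ) + 1 : ℕ) := by
    have h4 : (q : ℝ) / 4 ≤ ((q / 4 + 1 : ℕ) : ℝ) := by
      rw [div_le_iff₀ (by norm_num)]
      exact_mod_cast (by omega : q ≤ (q / 4 + 1) * 4)
    rw [← Real.log_sqrt (by linarith)]
    refine Real.log_le_log (by positivity) (le_trans ?_ h4)
    have h5 : 4 ≤ √(q : ℝ) := by
      rw [Real.le_sqrt (by norm_num) (by linarith)]
      linarith
    nlinarith [Real.sq_sqrt (show (0 : ℝ) ≤ q by linarith)]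
  have hlog0 : 0 ≤ Real.log q := Real.log_nonneg (by linarith)
  calc 3 / 64 * (Real.log q / q) ≤ 3 / (16 * ((q : ℝ) + 1)) * (Real.log q / 2) := by
        rw [div_mul_div_comm, div_mul_div_comm, div_le_div_iff₀ (by positivity) (by positivity)]
        nlinarith
    _ ≤ 3 / (16 * ((q : ℝ) + 1)) * ∑ k ∈ Finset.range (q / 4), ((k : ℝ) + 1)⁻¹ := by
        gcongr
        exact hlog.trans hharm
    _ ≤ ∑ k ∈ Finset.range (q / 4), (bCoeff q k - bCoeff q (k + 1)) ^ 2 := by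
        rw [Finset.mul_sum]
        refine Finset.sum_le_sum fun k hk => le_sq_bCoeff_sub ?_
        have := Finset.mem_range.1 hk
        omega
    _ ≤ ‖aVec q‖ ^ 2 := by
        rw [hsum]
        exact Finset.sum_le_sum_of_subset_of_nonneg
          (Finset.range_subset_range.2 (Nat.div_le_self _ _)) fun _ _ _ => sq_nonneg _

theorem aVec_ne_zero {q : ℕ} (hq : 2 ≤ q) : aVec q ≠ 0 := by
  intro h
  have h0 := congrArg (fun v => v ⟨0, by omega⟩) h
  have hb : bCoeff q 1 = 0 := by simpa [aVec, bCoeff_zero] using h0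
  have hq' : (2 : ℝ) ≤ q := by exact_mod_cast hq
  have : 0 < bCoeff q 1 := by
    refine Real.sqrt_pos.2 (div_pos ?_ (by positivity))
    push_cast
    linarith
  exact this.ne' hb

theorem maxConfig_scale_pos {q : ℕ} (hq : 2 ≤ q) :
    0 < √(q * ((q : ℝ) ^ 2 - 1) / 12) / ‖aVec q‖ := by
  have hq' : (2 : ℝ) ≤ q := by exact_mod_cast hq
  have : 0 < (q : ℝ) ^ 2 - 1 := by nlinarith
  exact div_pos (Real.sqrt_pos.2 (by positivity)) (norm_pos_iff.2 (aVec_ne_zero hq))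

theorem maxConfig_ne_zero {q : ℕ} (hq : 2 ≤ q) : maxConfig q ≠ 0 :=
  smul_ne_zero (maxConfig_scale_pos hq).ne' (aVec_ne_zero hq)

theorem maxConfig_mem_sumZero (q : ℕ) : maxConfig q ∈ sumZero q :=
  Submodule.smul_mem _ _ (mem_sumZero.2 (sum_aVec q))

/-- Standardization is scale-invariant, so the estimates for `aVec` apply directly. -/
theorem maxConfig_coord_div_norm {q : ℕ} (hq : 2 ≤ q) (j : Fin q) :
    √q / ‖maxConfig q‖ * maxConfig q j = √q / ‖aVec q‖ * aVec q j := by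
  have hc := maxConfig_scale_pos hq
  have ha : ‖aVec q‖ ≠ 0 := norm_ne_zero_iff.2 (aVec_ne_zero hq)
  rw [maxConfig]
  set c := √(q * ((q : ℝ) ^ 2 - 1) / 12) / ‖aVec q‖
  rw [norm_smul, Real.norm_of_nonneg hc.le, PiLp.smul_apply, smul_eq_mul]
  field_simp

theorem center_maxConfigShifted (q : ℕ) : center (maxConfigShifted q) = maxConfig q := by
  rcases Nat.eq_zero_or_pos q with rfl | hq
  · exact Subsingleton.elim _ _
  have h : ∑ i, maxConfigShifted q i = q * (((q : ℝ) + 1) / 2) := by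
    simp [maxConfigShifted, Finset.sum_add_distrib, mem_sumZero.1 (maxConfig_mem_sumZero q), ones]
  have hq' : (q : ℝ) ≠ 0 := by positivity
  rw [center, h, mul_div_cancel_left₀ _ hq', maxConfigShifted, add_sub_cancel_right]

/-! ### Concentration of the maximal configuration's coordinates. -/

/-- Markov's inequality for the standardized coordinates. -/
theorem stdMarginal_real_lt_abs_le {q : ℕ} (y : EuclideanSpace ℝ (Fin q)) (i : Fin q) {s : ℝ}
    (hs : 0 < s) :
    (stdMarginal y i).real {x | s < |x|} ≤ (∑ j, |√q / ‖y‖ * y j|) / s / q := by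
  classical
  rw [stdMarginal_real y i (B := {x | s < |x|})
    (measurableSet_lt measurable_const (by fun_prop))]
  have h := uniformOn_permSet_real_coord y i fun z => s < |√q / ‖y‖ * z|
  refine (le_of_eq h).trans ?_
  gcongr
  rw [le_div_iff₀ hs, ← nsmul_eq_mul]
  calc _ ≤ ∑ j ∈ Finset.univ.filter fun j => s < |√q / ‖y‖ * y j|, |√q / ‖y‖ * y j| :=
        Finset.card_nsmul_le_sum _ _ _ fun j hj => (Finset.mem_filter.1 hj).2.le
    _ ≤ _ := Finset.sum_le_sum_of_subset_of_nonneg (Finset.filter_subset _ _)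
        fun _ _ _ => abs_nonneg _

theorem isBigOInProb_stdMarginals_maxConfig (i : ℕ) :
    IsBigOInProb (stdMarginals maxConfig i) fun q => 1 / √(Real.log q) := by
  intro ε hε
  -- With this constant, the ℓ¹ bound 2 and the factor 5 in `hnorm` (from 64/3 ≤ 25), Markov's
  -- inequality yields ε/2.
  refine ⟨20 / ε, by positivity, ?_⟩
  filter_upwards [eventually_ge_atTop 16, eventually_gt_atTop i] with q hq hiq
  have hq' : (16 : ℝ) ≤ q := by exact_mod_cast hq
  have hlog : 0 < Real.log q := Real.log_pos (by linarith)
  have hL : 0 < √(Real.log q) := Real.sqrt_pos.2 hlog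
  have ha : 0 < ‖aVec q‖ := norm_pos_iff.2 (aVec_ne_zero (by omega))
  rw [stdMarginals, dif_pos hiq]
  refine (stdMarginal_real_lt_abs_le _ _ (by positivity)).trans_lt ?_
  have hsum : ∑ j, |√q / ‖maxConfig q‖ * maxConfig q j| ≤ √q / ‖aVec q‖ * 2 := by
    simp only [maxConfig_coord_div_norm (show 2 ≤ q by omega), abs_mul, ← Finset.mul_sum]
    rw [abs_of_nonneg (by positivity)]
    gcongr
    exact sum_abs_aVec_le q
  have hnorm : √q * √(Real.log q) ≤ 5 * (q * ‖aVec q‖) := by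
    rw [← Real.sqrt_mul (by positivity)]
    refine Real.sqrt_le_iff.2 ⟨by positivity, ?_⟩
    have h := log_div_le_norm_aVec_sq hq
    rw [← mul_div_assoc, div_le_iff₀ (by positivity)] at h
    have h2 : 0 ≤ ‖aVec q‖ ^ 2 * q ^ 2 := by positivity
    nlinarith
  calc _ ≤ (√q / ‖aVec q‖ * 2) / (20 / ε * (1 / √(Real.log q))) / q := by gcongr
    _ = (√q * √(Real.log q)) / (5 * (q * ‖aVec q‖)) * (ε / 2) := by
        field_simp
        norm_num
    _ ≤ 1 * (ε / 2) := by
        gcongr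
        exact div_le_one_of_le₀ hnorm (by positivity)
    _ < ε := by linarith

theorem tendsto_one_div_sqrt_log : Tendsto (fun q : ℕ => 1 / √(Real.log q)) atTop (𝓝 0) := by
  have := Real.tendsto_sqrt_atTop.comp (Real.tendsto_log_atTop.comp
    (tendsto_natCast_atTop_atTop (R := ℝ)))
  simp only [one_div]
  exact this.inv_tendsto_atTop

end PermUniform

theorem proposition4p7 :
    ¬ PermUniform.IsAPU PermUniform.maxConfig ∧
    ¬ PermUniform.IsAPUCentered PermUniform.maxConfigShifted ∧
    (∀ i : ℕ,
      PermUniform.IsBigOInProb (PermUniform.stdMarginals PermUniform.maxConfig i)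
        (fun q => 1 / √(Real.log q)) ∧
      PermUniform.TendsToZeroInProb (PermUniform.stdMarginals PermUniform.maxConfig i) ∧
      ¬ PermUniform.ConvergesInDistribution
        (PermUniform.stdMarginals PermUniform.maxConfig i) (ProbabilityTheory.gaussianReal 0 1)) ∧
    (∀ y : (q : ℕ) → EuclideanSpace ℝ (Fin q),
      (∀ q : ℕ, 2 ≤ q → y q ≠ 0 ∧ y q ∈ PermUniform.sumZero q ∧ Monotone fun i => y q i) →
      PermUniform.IsAPU y →
      ∀ i : ℕ, PermUniform.ConvergesInDistribution
        (PermUniform.stdMarginals y i) (ProbabilityTheory.gaussianReal 0 1)) := by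
  have hfin := fun i => PermUniform.isFiniteMeasure_stdMarginals PermUniform.maxConfig i
  have hzero : ∀ i, PermUniform.TendsToZeroInProb
      (PermUniform.stdMarginals PermUniform.maxConfig i) := fun i =>
    (PermUniform.isBigOInProb_stdMarginals_maxConfig i).tendsToZeroInProb
      PermUniform.tendsto_one_div_sqrt_log
  have hnot := fun i => (hzero i).not_convergesInDistribution_gaussianReal
  have hmax : ¬ PermUniform.IsAPU PermUniform.maxConfig := fun h =>
    hnot 0 (h.convergesInDistribution (fun q hq =>
      ⟨PermUniform.maxConfig_ne_zero hq, PermUniform.maxConfig_mem_sumZero q⟩) 0)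
  refine ⟨hmax, fun h => hmax ?_, fun i =>
    ⟨PermUniform.isBigOInProb_stdMarginals_maxConfig i, hzero i, hnot i⟩, fun y hy h i =>
    h.convergesInDistribution (fun q hq => ⟨(hy q hq).1, (hy q hq).2.1⟩) i⟩
  -- Centring removes the shift, so the claim reduces to `maxConfig`.
  unfold PermUniform.IsAPUCentered at h
  simpa only [PermUniform.center_maxConfigShifted] using h
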